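/- Let $H_{\rm o}(s)=B_{\rm o}(s)/A_{\rm o}(s)=K_{\rm o}\prod_{i=1}^{m}(s-z_i)\big/\prod_{i=1}^{n_{\rm o}}(s-p^{\rm o}_i)$ be a proper plant ($m\le n_{\rm o}$) with $B_{\rm o},A_{\rm o}$ real polynomials, $K_{\rm o}\neq 0$, and no zero $z_i$ in $[0,+\infty)$. A controller order $n_c\in\mathbb{N}$ is admissible if $n_c\ge n_{\rm o}-1$ and $n_c>m-n_{\rm o}$; the closed loop then has $n=n_c+n_{\rm o}$ poles and transfer function $H(s)=K\prod_{i=1}^{m}(s-z_i)\big/\prod_{i=1}^{n}(s-p_i)$ with gain $K>0$. Call $H$ PIR (positive impulse response) if its inverse Laplace transform $h$ satisfies $h(t)\ge 0$ for all $t\ge 0$. For $n\in\mathbb{N}$ let $$\sigma^{\star}(z,n)=\inf\Big\{\max_{1\le i\le n}\operatorname{Re}(p_i)\;:\;p\in\mathbb{C}^n,\ \operatorname{Re}(p_i)<0 \text{ for all } i,\ p_i\ne z_j \text{ for all } i,j,\ H \text{ is PIR for some } K>0\Big\}\in[-\infty,+\infty],$$ with $\inf\emptyset=+\infty$ (for $n>m$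 the gain $K>0$ does not affect whether $H$ is PIR). 1. If the plant has a real negative zero, then the minimum of $\sigma^{\star}(z,n)$ over all $n=n_c+n_{\rm o}$ with $n_c$ admissible is attained, and $$\min_{n}\sigma^{\star}(z,n)=\max_{z_i\in\mathbb{R}} z_i .$$ 2. If the plant has no real negative zero, then $\lim_{n\to+\infty}\sigma^{\star}(z,n)=-\infty$. -/

import Mathlib

open Filter Topology Polynomial

namespace MonotonicTracking

/-- A proper single-input single-output real plant of order `no` with `m` finite zeros,
`H_o(s) = B_o(s) / A_o(s) = K_o ∏ (s - z_i) / ∏ (s - p_i)`, where `B_o` and `A_o` have real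
coefficients. Zeros and poles are listed with multiplicity. -/
structure Plant (m no : ℕ) where
  /-- the gain `K_o` -/
  gain : ℝ
  /-- the zeros `z_i` -/
  zero : Fin m → ℂ
  /-- the open-loop poles -/
  pole : Fin no → ℂ
  /-- the numerator `B_o` -/
  num : ℝ[X]
  /-- the denominator `A_o` -/
  den : ℝ[X]
  num_eq : num.map (algebraMap ℝ ℂ) = C (gain : ℂ) * ∏ i, (X - C (zero i))
  den_eq : den.map (algebraMap ℝ ℂ) = ∏ i, (X - C (pole i))
  proper : m ≤ no

/-- The controller order `nc` is admissible for a plant of order `no` with `m` zeros: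
`nc ≥ no - 1` (arbitrary pole placement) and `nc > m - no` (strictly proper closed loop). -/
def AdmissibleOrder (m no nc : ℕ) : Prop :=
  (no : ℤ) - 1 ≤ nc ∧ (m : ℤ) - no < nc

/-- The closed-loop transfer function `H(s) = K ∏ (s - z_i) / ∏ (s - p_i)`. -/
noncomputable def closedLoop {m n : ℕ} (K : ℝ) (z : Fin m → ℂ) (p : Fin n → ℂ) (s : ℂ) : ℂ :=
  (K : ℂ) * (∏ i, (s - z i)) / ∏ i, (s - p i)

/-- `h` is the inverse Laplace transform of `H`: it is continuous on `[0, ∞)` and its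
(absolutely convergent) Laplace integral equals `H(s)` on some right half-plane.
By uniqueness of the Laplace transform, `h` is determined by `H` on `[0, ∞)`. -/
def IsInverseLaplace (h : ℝ → ℝ) (H : ℂ → ℂ) : Prop :=
  ContinuousOn h (Set.Ici 0) ∧
    ∃ c : ℝ, ∀ s : ℂ, c < s.re →
      MeasureTheory.IntegrableOn (fun t : ℝ => Complex.exp (-s * t) * (h t : ℂ)) (Set.Ioi 0) ∧
        ∫ t in Set.Ioi (0 : ℝ), Complex.exp (-s * t) * (h t : ℂ) = H s

/-- Positive impulse response: the inverse Laplace transform of `H` is nonnegative on `[0, ∞)`. -/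
def IsPIR (H : ℂ → ℂ) : Prop :=
  ∃ h : ℝ → ℝ, IsInverseLaplace h H ∧ ∀ t : ℝ, 0 ≤ t → 0 ≤ h t

/-- The decay rate `max_i Re p_i` of a closed loop with poles `p`. -/
noncomputable def decayRate {n : ℕ} (p : Fin n → ℂ) : EReal :=
  ⨆ i, (((p i).re : ℝ) : EReal)

/-- The closed-loop poles `p` are feasible for the zeros `z`: they are stable, cancel no zero, and
with some positive gain `K` (the gain is free, through the static gain of the controller) the
closed loop is PIR. -/
def Feasible {m n : ℕ} (z : Fin m → ℂ) (p : Fin n → ℂ) : Prop :=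
  (∀ i, (p i).re < 0) ∧ (∀ i j, p i ≠ z j) ∧ ∃ K : ℝ, 0 < K ∧ IsPIR (closedLoop K z p)

/-- The fastest decay rate `σ*(z, n)` achievable with `n` closed-loop poles, as an infimum in the
extended reals (`⊤` if there are no feasible poles, `⊥` if it is unbounded below). -/
noncomputable def fastestDecayRate {m : ℕ} (z : Fin m → ℂ) (n : ℕ) : EReal :=
  sInf {σ : EReal | ∃ p : Fin n → ℂ, Feasible z p ∧ σ = decayRate p}

end MonotonicTracking

namespace MonotonicTracking

/-! Lower bound (Landau). Suppose a real zero `x` lies to the right of all poles and `h ≥ 0`. Expand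
`H` about a large real `s₀`: the Taylor coefficients of `z ↦ H (s₀ - z)` at `0` are moments of
`e^(-s₀ t) h(t) dt` over factorials, hence nonnegative, and the series converges at `s₀ - x`, where
its sum is `H x = 0`. All terms vanish, so `H s₀ = 0`, which is false beyond all zeros
(`laplace_eq_zero_of_continuation_zero`, `le_decayRate_of_feasible`).

Upper bound. Put all `n` poles at one real point `p`, so that `h` is `e^(pt)` times a polynomial.
Split the monic numerator into real linear factors and a factor `Q` positive on the real line. For
`Q`, with `N = n - 1`, the polynomial is `t^N / N!` times an approximation of `Q (p + N / t)`, hence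
nonnegative once `n` is large (`eventually_impulse_taylor_nonneg`). Linear factors with root at most
`p` preserve nonnegativity (`impulse_prod_mul_nonneg`). If there are real zeros, `p` decreases to
the largest one with `n` fixed; if there are none, `p` is arbitrary. -/

/-! ### Landau's argument for nonnegative functions -/

open MeasureTheory ProbabilityTheory in
/-- Landau's argument: a nonnegative function whose Laplace transform continues holomorphically to
`Re s > σ` has no zero of the continuation to the right of `σ` on the real axis, unless the
transform vanishes. -/
theorem laplace_eq_zero_of_continuation_zero {h : ℝ → ℝ} {H : ℂ → ℂ} {σ x c s₀ : ℝ}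
    (hcont : ContinuousOn h (Set.Ici 0)) (hnonneg : ∀ t, 0 ≤ t → 0 ≤ h t)
    (hH : ∀ s : ℂ, c < s.re →
      IntegrableOn (fun t : ℝ => Complex.exp (-s * t) * (h t : ℂ)) (Set.Ioi 0) ∧
        ∫ t in Set.Ioi (0 : ℝ), Complex.exp (-s * t) * (h t : ℂ) = H s)
    (hd : ∀ s : ℂ, σ < s.re → DifferentiableAt ℂ H s) (hx : σ < x) (hxz : H x = 0)
    (hc : c < s₀) (hs : x < s₀) : H s₀ = 0 := by
  -- The weight `e^(-s₀ t) h(t)` turns the Laplace transform near `s₀` into a moment generating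
  -- function near `0`, whose derivatives are moments.
  set w : ℝ → ℝ := fun t => Real.exp (-s₀ * t) * h t with hw
  set ν : Measure ℝ := (volume.restrict (Set.Ioi 0)).withDensity (fun t => ENNReal.ofReal (w t))
    with hν
  have hwm : AEMeasurable w (volume.restrict (Set.Ioi 0)) := by
    refine ContinuousOn.aemeasurable ?_ measurableSet_Ioi
    exact (by fun_prop : Continuous fun t : ℝ => Real.exp (-s₀ * t)).continuousOn.mul
      (hcont.mono Set.Ioi_subset_Ici_self)
  have hw0 : ∀ᵐ t ∂(volume.restrict (Set.Ioi 0)), 0 ≤ w t := by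
    filter_upwards [ae_restrict_mem measurableSet_Ioi] with t ht
    exact mul_nonneg (Real.exp_pos _).le (hnonneg t (le_of_lt ht))
  have hfin : ∀ᵐ t ∂(volume.restrict (Set.Ioi (0:ℝ))), ENNReal.ofReal (w t) < ⊤ := by simp
  have hint : ∀ g : ℝ → ℂ, ∫ t, g t ∂ν = ∫ t in Set.Ioi 0, (w t : ℂ) * g t := by
    intro g
    rw [hν, integral_withDensity_eq_integral_toReal_smul₀ hwm.ennreal_ofReal hfin]
    refine integral_congr_ae ?_
    filter_upwards [hw0] with t ht
    simp [ENNReal.toReal_ofReal ht]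
  have hmgf : ∀ z : ℂ, z.re < s₀ - c → complexMGF id ν z = H (s₀ - z) := by
    intro z hz
    rw [complexMGF, hint, ← (hH (s₀ - z) (by simp; linarith)).2]
    congr 1
    ext t
    simp only [hw, id]
    push_cast
    rw [mul_right_comm, ← Complex.exp_add]
    ring_nf
  have hset : Set.Iio (s₀ - c) ⊆ integrableExpSet id ν := by
    intro u hu
    simp only [integrableExpSet, Set.mem_ofPred_eq, hν]
    rw [integrable_withDensity_iff_integrable_smul₀' hwm.ennreal_ofReal hfin]
    have := (hH (s₀ - u : ℝ) (by simpa using by linarith [Set.mem_Iio.1 hu])).1.norm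
    refine this.congr ?_
    filter_upwards [hw0, ae_restrict_mem measurableSet_Ioi] with t ht ht'
    have h1 := hnonneg t (le_of_lt ht')
    rw [ENNReal.toReal_ofReal ht]
    simp only [hw, id, smul_eq_mul, norm_mul, Complex.norm_exp]
    rw [Complex.norm_real, Real.norm_of_nonneg h1, mul_right_comm, ← Real.exp_add]
    congr 2
    simp
    ring
  have h0 : (0 : ℂ).re ∈ interior (integrableExpSet id ν) := by
    refine interior_mono hset ?_
    rw [interior_Iio]; simpa using hc
  have hev : complexMGF id ν =ᶠ[𝓝 0] fun z => H (s₀ - z) := by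
    have : ∀ᶠ z : ℂ in 𝓝 0, z.re < s₀ - c :=
      Complex.continuous_re.continuousAt.eventually_lt continuousAt_const (by simpa using hc)
    exact this.mono fun z hz => hmgf z hz
  have hder : ∀ k, iteratedDeriv k (fun z => H (s₀ - z)) 0 = ((∫ t, t ^ k ∂ν : ℝ) : ℂ) := by
    intro k
    rw [← hev.iteratedDeriv_eq, iteratedDeriv_complexMGF h0, ← integral_complex_ofReal]
    simp
  have hball : DifferentiableOn ℂ (fun z : ℂ => H (s₀ - z)) (Metric.ball 0 (s₀ - σ)) := by
    intro z hz
    have hz' : ‖z‖ < s₀ - σ := by simpa using hz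
    have h1 : σ < (s₀ - z : ℂ).re := by
      have := Complex.re_le_norm z
      simp; linarith
    exact ((hd _ h1).comp z (by fun_prop)).differentiableWithinAt
  have hsum := Complex.hasSum_taylorSeries_on_ball hball (z := ((s₀ - x : ℝ) : ℂ)) (by
    simp only [mem_ball_zero_iff, Complex.norm_real, Real.norm_eq_abs]
    rw [abs_of_pos] <;> linarith)
  have hval : H (s₀ - ((s₀ - x : ℝ) : ℂ)) = 0 := by
    rw [← hxz]; congr 1; push_cast; ring
  simp only [hder, hval, sub_zero] at hsum
  have hre : HasSum (fun k : ℕ => ((k.factorial : ℝ)⁻¹ * ((s₀ - x) ^ k * ∫ t, t ^ k ∂ν))) 0 := by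
    rw [← Complex.hasSum_ofReal]
    convert! hsum using 2
    push_cast
    simp only [smul_eq_mul]
  -- Nonnegative terms with sum zero all vanish; the term `k = 0` is `H s₀`.
  have hk0 := (hasSum_zero_iff_of_nonneg ?_).1 hre
  · have := congrFun hk0 0
    have h2 := hder 0
    simp at this h2
    rw [h2]
    simp [this]
  · intro k
    have hν0 : ∀ᵐ t ∂ν, 0 ≤ t := by
      refine (withDensity_absolutelyContinuous _ _).ae_le ?_
      filter_upwards [ae_restrict_mem measurableSet_Ioi] with t ht using le_of_lt ht
    have : 0 ≤ ∫ t, t ^ k ∂ν := integral_nonneg_of_ae (by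
      filter_upwards [hν0] with t ht using pow_nonneg ht k)
    positivity

/-! ### Impulse response of a single multiple pole -/

theorem integrableOn_pow_mul_exp (k : ℕ) {w : ℂ} (hw : 0 < w.re) :
    MeasureTheory.IntegrableOn (fun t : ℝ => (t : ℂ) ^ k * Complex.exp (-w * t)) (Set.Ioi 0) := by
  have h := integrableOn_rpow_mul_exp_neg_mul_rpow (p := 1) (s := k) (b := w.re)
    (by linarith [Nat.cast_nonneg (α := ℝ) k]) one_pos hw
  refine MeasureTheory.Integrable.mono' h (by fun_prop) ?_
  filter_upwards [MeasureTheory.ae_restrict_mem measurableSet_Ioi] with t ht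
  have ht : 0 < t := ht
  simp [Complex.norm_exp, abs_of_pos ht]

/-- The Laplace transform of `t ^ k / k!` at `w` is `(w ^ (k + 1))⁻¹`. -/
theorem integral_pow_div_factorial_mul_exp (k : ℕ) {w : ℂ} (hw : 0 < w.re) :
    ∫ t in Set.Ioi (0 : ℝ), (t : ℂ) ^ k / (k.factorial : ℂ) * Complex.exp (-w * t)
      = (w ^ (k + 1))⁻¹ := by
  have hw0 : w ≠ 0 := by rintro rfl; simp at hw
  have hI : ∀ k : ℕ, MeasureTheory.IntegrableOn
      (fun t : ℝ => (t : ℂ) ^ k / (k.factorial : ℂ) * Complex.exp (-w * t)) (Set.Ioi 0) := by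
    intro k
    refine ((integrableOn_pow_mul_exp k hw).const_mul (k.factorial : ℂ)⁻¹).congr ?_
    filter_upwards with t
    ring
  have hexp : ∀ t : ℝ, HasDerivAt (fun t : ℝ => Complex.exp (-w * t))
      (Complex.exp (-w * t) * (-w)) t := by
    intro t
    have h1 : HasDerivAt (fun t : ℝ => -w * (t : ℂ)) (-w) t := by
      simpa using (Complex.ofRealCLM.hasDerivAt (x := t)).const_mul (-w)
    exact h1.cexp
  have hlim : ∀ k : ℕ, Tendsto (fun t : ℝ => (t : ℂ) ^ k / (k.factorial : ℂ) *
      Complex.exp (-w * t)) atTop (𝓝 0) := by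
    intro k
    have h := (tendsto_rpow_mul_exp_neg_mul_atTop_nhds_zero k w.re hw).const_mul
      (k.factorial : ℝ)⁻¹
    rw [mul_zero] at h
    refine squeeze_zero_norm' ?_ h
    filter_upwards [eventually_gt_atTop 0] with t ht
    simp [Complex.norm_exp, abs_of_pos ht]
    apply le_of_eq; ring
  induction k with
  | zero =>
    have := MeasureTheory.integral_Ioi_of_hasDerivAt_of_tendsto' (a := 0)
      (fun t _ => hexp t) (by
        refine ((hI 0).mul_const (-w)).congr ?_
        filter_upwards with t
        simp) (by simpa using hlim 0)
    rw [MeasureTheory.integral_mul_const] at this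
    simp at this ⊢
    field_simp
    rw [mul_comm]; exact this
  | succ k ih =>
    -- Integrated over `(0, ∞)`, this gives `I k = w * I (k + 1)`, since both boundary values
    -- vanish.
    have hd : ∀ t : ℝ, HasDerivAt
        (fun t : ℝ => (t : ℂ) ^ (k + 1) / ((k + 1).factorial : ℂ) * Complex.exp (-w * t))
        ((t : ℂ) ^ k / (k.factorial : ℂ) * Complex.exp (-w * t) -
          w * ((t : ℂ) ^ (k + 1) / ((k + 1).factorial : ℂ) * Complex.exp (-w * t))) t := by
      intro t
      have h1 : HasDerivAt (fun t : ℝ => (t : ℂ) ^ (k + 1)) ((k + 1 : ℕ) * (t : ℂ) ^ k) t := by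
        simpa using (Complex.ofRealCLM.hasDerivAt (x := t)).fun_pow (k + 1)
      convert! (h1.div_const ((k + 1).factorial : ℂ)).mul (hexp t) using 1
      have : (k.factorial : ℂ) ≠ 0 := by exact_mod_cast k.factorial_ne_zero
      have : (k + 1 : ℂ) ≠ 0 := by exact_mod_cast k.succ_ne_zero
      rw [Nat.factorial_succ]
      push_cast
      field_simp
      ring
    have := MeasureTheory.integral_Ioi_of_hasDerivAt_of_tendsto' (a := 0)
      (fun t _ => hd t) ((hI k).sub ((hI (k + 1)).const_mul w)) (hlim (k + 1))
    rw [MeasureTheory.integral_sub (hI k) ((hI (k + 1)).const_mul w), ih,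
      MeasureTheory.integral_const_mul] at this
    simp only [Complex.ofReal_zero, ne_eq, Nat.add_eq_zero_iff, one_ne_zero, and_false,
      not_false_eq_true, zero_pow, zero_div, zero_mul, sub_zero] at this
    have h2 := sub_eq_zero.1 this
    rw [pow_succ, mul_inv, h2]
    field_simp

/-- The inverse Laplace transform of `F(s) / s ^ n`, for `F` of degree less than `n`. -/
noncomputable def impulse (n : ℕ) (F : ℝ[X]) (t : ℝ) : ℝ :=
  ∑ j ∈ Finset.range n, F.coeff j * (t ^ (n - 1 - j) / ((n - 1 - j).factorial : ℝ))

theorem continuous_impulse (n : ℕ) (F : ℝ[X]) : Continuous (impulse n F) := by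
  unfold impulse; fun_prop

/-- Transform of `(s + a) F / s^(n+1) = F / s^n + a F / s^(n+1)`; this drives the induction over
real zeros. -/
theorem impulse_X_add_C_mul (n : ℕ) (a : ℝ) (F : ℝ[X]) (t : ℝ) :
    impulse (n + 1) ((X + C a) * F) t = impulse n F t + a * impulse (n + 1) F t := by
  simp only [impulse, add_mul, coeff_add, coeff_C_mul, Finset.sum_add_distrib, Finset.mul_sum]
  congr 1
  · rw [Finset.sum_range_succ']
    simp only [coeff_X_mul, mul_coeff_zero, coeff_X_zero, zero_mul, add_zero]
    refine Finset.sum_congr rfl fun j hj => ?_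
    rw [show n + 1 - 1 - (j + 1) = n - 1 - j by omega]
  · exact Finset.sum_congr rfl fun j _ => by ring

/-- Expanding `F` in powers of `s - p` splits `H` into terms `(s - p)^(j - n)`, which are inverted
one by one. -/
theorem isInverseLaplace_impulse {m n : ℕ} {z : Fin m → ℂ} {F : ℝ[X]}
    (hF : F.map (algebraMap ℝ ℂ) = ∏ i, (X - C (z i))) (hmn : m < n) (p : ℝ) :
    IsInverseLaplace (fun t => Real.exp (p * t) * impulse n (taylor p F) t)
      (closedLoop 1 z (fun _ : Fin n => (p : ℂ))) := by
  have hdeg : F.natDegree = m := by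
    rw [← natDegree_map (algebraMap ℝ ℂ), hF, natDegree_prod_of_monic _ _ fun i _ => monic_X_sub_C _]
    simp
  refine ⟨(by fun_prop : Continuous fun t : ℝ => Real.exp (p * t)).mul
    (continuous_impulse _ _) |>.continuousOn, p, fun s hs => ?_⟩
  have hw : 0 < (s - p).re := by simpa using hs
  have hw0 : s - p ≠ 0 := by intro h; simp [h] at hw
  have hfun : (fun t : ℝ => Complex.exp (-s * t) *
      ((Real.exp (p * t) * impulse n (taylor p F) t : ℝ) : ℂ)) = fun t : ℝ =>
      ∑ j ∈ Finset.range n, ((taylor p F).coeff j : ℂ) * ((t : ℂ) ^ (n - 1 - j) /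
        ((n - 1 - j).factorial : ℂ) * Complex.exp (-(s - p) * t)) := by
    ext t
    simp only [impulse]
    push_cast
    rw [← mul_assoc, ← Complex.exp_add, Finset.mul_sum]
    refine Finset.sum_congr rfl fun j _ => ?_
    rw [show -s * (t : ℂ) + p * t = -(s - p) * t by ring]
    ring
  have hint : ∀ j ∈ Finset.range n, MeasureTheory.IntegrableOn (fun t : ℝ =>
      ((taylor p F).coeff j : ℂ) * ((t : ℂ) ^ (n - 1 - j) /
        ((n - 1 - j).factorial : ℂ) * Complex.exp (-(s - p) * t))) (Set.Ioi 0) := by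
    intro j _
    refine ((integrableOn_pow_mul_exp (n - 1 - j) hw).const_mul
      (((taylor p F).coeff j : ℂ) / ((n - 1 - j).factorial : ℂ))).congr ?_
    filter_upwards with t
    ring
  rw [hfun]
  refine ⟨MeasureTheory.integrable_finsetSum _ hint, ?_⟩
  rw [MeasureTheory.integral_finsetSum _ hint]
  simp only [MeasureTheory.integral_const_mul, integral_pow_div_factorial_mul_exp _ hw]
  have heval : ∏ i, (s - z i) = ∑ j ∈ Finset.range n, ((taylor p F).coeff j : ℂ) * (s - p) ^ j := by
    have h1 : ∏ i, (s - z i) = (F.map (algebraMap ℝ ℂ)).eval s := by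
      rw [hF, eval_prod]; simp
    have h2 : (F.map (algebraMap ℝ ℂ)).eval s =
        ((taylor p F).map (algebraMap ℝ ℂ)).eval (s - p) := by
      rw [map_taylor, taylor_eval]; simp
    rw [h1, h2, eval_eq_sum_range' (n := n)]
    · simp [-map_taylor]
    · rw [natDegree_map, natDegree_taylor, hdeg]; exact hmn
  rw [closedLoop, heval, Finset.prod_const, Finset.card_univ, Fintype.card_fin]
  rw [Complex.ofReal_one, one_mul, Finset.sum_div]
  refine Finset.sum_congr rfl fun j hj => ?_
  have hj : j < n := Finset.mem_range.1 hj
  rw [mul_div_assoc, div_eq_mul_inv ((s - p) ^ j)]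
  congr 1
  rw [show (s - p) ^ n = (s - p) ^ j * (s - p) ^ (n - 1 - j + 1) by
    rw [← pow_add]; congr 1; omega]
  rw [mul_inv, ← mul_assoc, mul_inv_cancel₀ (pow_ne_zero _ hw0), one_mul]

/-! ### Nonnegativity for large order -/

/-- The quotient by `(1 + x)^d` is positive, with positive limit at infinity, so compactness bounds
it away from zero. This margin absorbs small changes of the coefficients. -/
theorem exists_mul_one_add_pow_le_eval {G : ℝ[X]} (hG : ∀ x, 0 ≤ x → 0 < G.eval x) :
    ∃ δ > 0, ∀ x, 0 ≤ x → δ * (1 + x) ^ G.natDegree ≤ G.eval x := by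
  have hG0 : G ≠ 0 := by rintro rfl; simpa using hG 0 le_rfl
  have hq : ∀ x : ℝ, ((X + C 1) ^ G.natDegree : ℝ[X]).eval x = (1 + x) ^ G.natDegree := by
    intro x; simp [add_comm]
  have hlim := div_tendsto_atTop_leadingCoeff_div_of_degree_eq G ((X + C 1) ^ G.natDegree) (by
    rw [degree_eq_natDegree hG0, degree_pow, degree_X_add_C]; simp)
  rw [(monic_X_add_C 1).pow _ |>.leadingCoeff, div_one] at hlim
  simp only [hq] at hlim
  have hlc : 0 < G.leadingCoeff := by
    refine lt_of_le_of_ne (ge_of_tendsto hlim ?_) (leadingCoeff_ne_zero.2 hG0).symm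
    filter_upwards [eventually_ge_atTop 0] with x hx
    have := hG x hx
    positivity
  obtain ⟨x₀, hx₀⟩ := eventually_atTop.1 (hlim.eventually (lt_mem_nhds (half_lt_self hlc)))
  have hcont : ContinuousOn (fun x : ℝ => G.eval x / (1 + x) ^ G.natDegree)
      (Set.Icc 0 (max 0 x₀)) := by
    refine G.continuous.continuousOn.div (by fun_prop) fun x hx => ?_
    have : 0 ≤ x := hx.1
    positivity
  obtain ⟨y, hy, hmin⟩ := isCompact_Icc.exists_isMinOn
    (Set.nonempty_Icc.2 (le_max_left 0 x₀)) hcont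
  have hy0 : 0 ≤ y := hy.1
  have hGy := hG y hy0
  refine ⟨min (G.leadingCoeff / 2) (G.eval y / (1 + y) ^ G.natDegree), by positivity,
    fun x hx => ?_⟩
  rw [← le_div_iff₀ (by positivity)]
  rcases le_total x (max 0 x₀) with h | h
  · exact (min_le_right _ _).trans (hmin ⟨hx, h⟩)
  · exact (min_le_left _ _).trans (hx₀ x ((le_max_right _ _).trans h)).le

/-- The perturbation costs at most `δ * ∑ x^j ≤ δ * (1 + x)^d`, as every binomial coefficient is at
least `1`. -/
theorem sum_coeff_mul_pow_nonneg {d : ℕ} {δ : ℝ} {a b : ℕ → ℝ}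
    (ha : ∀ x, 0 ≤ x → δ * (1 + x) ^ d ≤ ∑ j ∈ Finset.range (d + 1), a j * x ^ j)
    (hab : ∀ j ∈ Finset.range (d + 1), |b j - a j| ≤ δ) {x : ℝ} (hx : 0 ≤ x) :
    0 ≤ ∑ j ∈ Finset.range (d + 1), b j * x ^ j := by
  have hδ : 0 ≤ δ := (abs_nonneg (b 0 - a 0)).trans (hab 0 (by simp))
  have h1 : ∑ j ∈ Finset.range (d + 1), x ^ j ≤ (1 + x) ^ d := by
    rw [add_comm 1 x, add_pow]
    refine Finset.sum_le_sum fun j hj => ?_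
    rw [one_pow, mul_one]
    refine le_mul_of_one_le_right (by positivity) ?_
    have : 1 ≤ d.choose j := Nat.choose_pos (by simpa [Nat.lt_succ_iff] using hj)
    exact_mod_cast this
  have h2 : ∑ j ∈ Finset.range (d + 1), (a j * x ^ j - δ * x ^ j) ≤
      ∑ j ∈ Finset.range (d + 1), b j * x ^ j := by
    refine Finset.sum_le_sum fun j hj => ?_
    have := (abs_le.1 (hab j hj)).1
    rw [← sub_mul]
    exact mul_le_mul_of_nonneg_right (by linarith) (by positivity)
  rw [Finset.sum_sub_distrib, ← Finset.mul_sum] at h2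
  nlinarith [ha x hx]

/-- The factors `N.descFactorial j / N^j` tend to `1`, so the sum is a perturbation of `F (N / t)`
in its coefficients. -/
theorem impulse_eq_of_natDegree_lt {N : ℕ} {F : ℝ[X]} (hN : F.natDegree < N) {t : ℝ} (ht : 0 < t) :
    impulse (N + 1) F t = t ^ N / (N.factorial : ℝ) * ∑ j ∈ Finset.range (F.natDegree + 1),
      F.coeff j * ((N.descFactorial j : ℝ) / (N : ℝ) ^ j) * (N / t) ^ j := by
  have hN0 : (N : ℝ) ≠ 0 := by
    have : N ≠ 0 := by omega
    exact_mod_cast this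
  rw [impulse, Finset.mul_sum]
  symm
  refine Finset.sum_subset_zero_on_sdiff (by simpa using by omega) (fun j hj => ?_) fun j hj => ?_
  · have : F.natDegree < j := by
      simp at hj; omega
    simp [coeff_eq_zero_of_natDegree_lt this]
  · have hj : j ≤ N := by simp at hj; omega
    have h1 : ((N - j).factorial : ℝ) * N.descFactorial j = N.factorial := by
      exact_mod_cast Nat.factorial_mul_descFactorial hj
    have h2 : t ^ N = t ^ (N - j) * t ^ j := by rw [← pow_add]; congr 1; omega
    have h3 : ((N - j).factorial : ℝ) ≠ 0 := by positivity
    have h4 : (N.descFactorial j : ℝ) ≠ 0 := by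
      have := Nat.descFactorial_pos.2 hj
      positivity
    rw [Nat.add_sub_cancel, ← h1, h2, div_pow]
    field_simp

theorem tendsto_descFactorial_div_pow (j : ℕ) :
    Tendsto (fun N : ℕ => (N.descFactorial j : ℝ) / (N : ℝ) ^ j) atTop (𝓝 1) := by
  induction j with
  | zero => simp
  | succ j ih =>
    have h1 : Tendsto (fun N : ℕ => 1 - (j : ℝ) / N) atTop (𝓝 1) := by
      simpa using (tendsto_const_div_atTop_nhds_zero_nat (j : ℝ)).const_sub 1
    have := h1.mul ih
    rw [one_mul] at this
    refine this.congr' ?_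
    filter_upwards [eventually_gt_atTop j] with N hN
    have hN0 : (N : ℝ) ≠ 0 := by
      have : N ≠ 0 := by omega
      exact_mod_cast this
    rw [Nat.descFactorial_succ, Nat.cast_mul, Nat.cast_sub hN.le]
    field_simp
    ring

/-- Coefficients converge jointly as `p → p₀` and `N → ∞`, so one `N₀` serves a whole neighbourhood
of `p₀`. This later lets `p` move while `n` stays fixed. -/
theorem eventually_impulse_taylor_nonneg {Q : ℝ[X]} {p₀ : ℝ} (hQ : ∀ x, 0 < Q.eval x) :
    ∃ ε > 0, ∃ N₀, ∀ p, |p - p₀| < ε → ∀ n ≥ N₀, ∀ t, 0 ≤ t → 0 ≤ impulse n (taylor p Q) t := by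
  obtain ⟨δ, hδ, hle⟩ := exists_mul_one_add_pow_le_eval (G := taylor p₀ Q)
    (fun x _ => by rw [taylor_eval]; exact hQ _)
  simp only [natDegree_taylor, eval_eq_sum_range] at hle
  have hlim : ∀ j, Tendsto (fun q : ℝ × ℕ => (taylor q.1 Q).coeff j *
      ((q.2.descFactorial j : ℝ) / (q.2 : ℝ) ^ j)) (𝓝 p₀ ×ˢ atTop)
      (𝓝 ((taylor p₀ Q).coeff j)) := by
    intro j
    have h1 : Tendsto (fun p : ℝ => (taylor p Q).coeff j) (𝓝 p₀) (𝓝 ((taylor p₀ Q).coeff j)) := by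
      simp only [taylor_coeff]
      exact (hasseDeriv j Q).continuous.tendsto p₀
    simpa using (h1.comp tendsto_fst).mul ((tendsto_descFactorial_div_pow j).comp tendsto_snd)
  have hev : ∀ᶠ q : ℝ × ℕ in 𝓝 p₀ ×ˢ atTop, ∀ j ∈ Finset.range (Q.natDegree + 1),
      |(taylor q.1 Q).coeff j * ((q.2.descFactorial j : ℝ) / (q.2 : ℝ) ^ j) -
        (taylor p₀ Q).coeff j| ≤ δ := by
    rw [Finset.eventually_all]
    intro j _
    filter_upwards [(hlim j).eventually (Metric.ball_mem_nhds _ hδ)] with q hq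
    exact le_of_lt hq
  obtain ⟨u, hu, v, hv, huv⟩ := eventually_prod_iff.1 hev
  obtain ⟨ε, hε, hεu⟩ := Metric.eventually_nhds_iff.1 hu
  obtain ⟨N₁, hN₁⟩ := eventually_atTop.1 hv
  refine ⟨ε, hε, max N₁ (Q.natDegree + 1) + 1, fun p hp n hn t ht => ?_⟩
  obtain ⟨N, rfl⟩ : ∃ N, n = N + 1 := ⟨n - 1, by omega⟩
  have hpos : ∀ t, 0 < t → 0 ≤ impulse (N + 1) (taylor p Q) t := by
    intro t ht
    rw [impulse_eq_of_natDegree_lt (by rw [natDegree_taylor]; omega) ht, natDegree_taylor]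
    have := sum_coeff_mul_pow_nonneg hle
      (huv (hεu (by rwa [Real.dist_eq])) (hN₁ N (by omega))) (x := N / t) (by positivity)
    positivity
  -- The formula in `N / t` excludes `t = 0`, which is recovered by continuity.
  have hcl : Set.Ici (0 : ℝ) ⊆ {t | 0 ≤ impulse (N + 1) (taylor p Q) t} := by
    rw [← closure_Ioi]
    exact closure_minimal hpos (isClosed_le continuous_const (continuous_impulse _ _))
  exact hcl ht

/-- After the shift by `p`, a factor with root `a ≤ p` becomes `X + (p - a)` with `p - a ≥ 0`; each
one raises the order threshold by one. -/
theorem impulse_prod_mul_nonneg (S : Multiset ℝ) {p : ℝ} (hS : ∀ r ∈ S, r ≤ p) {Q : ℝ[X]} {N₀ : ℕ}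
    (hQ : ∀ n ≥ N₀, ∀ t, 0 ≤ t → 0 ≤ impulse n (taylor p Q) t) :
    ∀ n ≥ N₀ + S.card, ∀ t, 0 ≤ t →
      0 ≤ impulse n (taylor p ((S.map fun a => X - C a).prod * Q)) t := by
  induction S using Multiset.induction_on with
  | empty => simpa using hQ
  | cons a S ih =>
    intro n hn t ht
    have ih := ih fun r hr => hS r (Multiset.mem_cons_of_mem hr)
    rw [Multiset.card_cons] at hn
    obtain ⟨k, rfl⟩ : ∃ k, n = k + 1 := ⟨n - 1, by omega⟩
    rw [Multiset.map_cons, Multiset.prod_cons, mul_assoc, taylor_mul,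
      show taylor p (X - C a) = X + C (p - a) by simp; ring, impulse_X_add_C_mul]
    have h1 := ih k (by omega) t ht
    have h2 := ih (k + 1) (by omega) t ht
    have h3 : 0 ≤ p - a := sub_nonneg.2 (hS a (Multiset.mem_cons_self a S))
    positivity

theorem eval_pos_of_monic_of_roots_eq_zero {Q : ℝ[X]} (hm : Q.Monic) (hr : Q.roots = 0) (x : ℝ) :
    0 < Q.eval x := by
  have hne : ∀ y, Q.eval y ≠ 0 := by
    intro y hy
    have : y ∈ Q.roots := (mem_roots hm.ne_zero).2 hy
    simp [hr] at this
  by_contra! hx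
  have hlt := lt_of_le_of_ne hx (hne x)
  rcases Nat.eq_zero_or_pos Q.natDegree with h | h
  · rw [hm.natDegree_eq_zero.1 h] at hx
    norm_num at hx
  · have := tendsto_atTop_of_leadingCoeff_nonneg Q (natDegree_pos_iff_degree_pos.1 h)
      (by rw [hm.leadingCoeff]; exact zero_le_one)
    obtain ⟨y, hy⟩ := (this.eventually_gt_atTop 0).exists
    obtain ⟨c, hc⟩ := mem_range_of_exists_le_of_exists_ge Q.continuous ⟨x, hx⟩ ⟨y, hy.le⟩
    exact hne c hc

/-- If the real zeros are at most `p₀`, then poles placed all at one point slightly to the right of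
`p₀` give a nonnegative impulse response, uniformly for all large orders. -/
theorem exists_impulse_taylor_nonneg {F : ℝ[X]} (hF : F.Monic) {p₀ : ℝ}
    (hroots : ∀ r, F.eval r = 0 → r ≤ p₀) :
    ∃ ε > 0, ∃ N₀, ∀ p, p₀ ≤ p → p < p₀ + ε → ∀ n ≥ N₀, ∀ t, 0 ≤ t →
      0 ≤ impulse n (taylor p F) t := by
  obtain ⟨Q, hQ, -, hQr⟩ := exists_prod_multiset_X_sub_C_mul F
  have hQm : Q.Monic := by
    refine (monic_multiset_prod_of_monic F.roots _ fun a _ => monic_X_sub_C a).of_mul_monic_left ?_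
    rw [hQ]; exact hF
  obtain ⟨ε, hε, N₀, h⟩ := eventually_impulse_taylor_nonneg (p₀ := p₀)
    (eval_pos_of_monic_of_roots_eq_zero hQm hQr)
  refine ⟨ε, hε, N₀ + F.roots.card, fun p hp hp' => ?_⟩
  have := impulse_prod_mul_nonneg F.roots (p := p)
    (fun r hr => (hroots r ((mem_roots hF.ne_zero).1 hr)).trans hp)
    (h p (by rw [abs_lt]; constructor <;> linarith))
  rwa [hQ] at this

/-! ### Bounds on the decay rate -/

theorem le_decayRate_of_feasible {m n : ℕ} {z : Fin m → ℂ} {p : Fin n → ℂ} (hp : Feasible z p)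
    {i : Fin m} {x : ℝ} (hx : z i = x) : (x : EReal) ≤ decayRate p := by
  by_contra! hlt
  obtain ⟨σ, hσ, hσx⟩ := EReal.lt_iff_exists_real_btwn.1 hlt
  have hpσ : ∀ j, (p j).re < σ := fun j => by
    exact_mod_cast (le_iSup (fun j => (((p j).re : ℝ) : EReal)) j).trans_lt hσ
  have hσx : σ < x := by exact_mod_cast hσx
  obtain ⟨-, -, K, hK, h, ⟨hcont, c, hH⟩, hnonneg⟩ := hp
  have hden : ∀ s : ℂ, σ < s.re → ∏ j, (s - p j) ≠ 0 := by
    intro s hs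
    refine Finset.prod_ne_zero_iff.2 fun j _ hj => ?_
    rw [sub_eq_zero.1 hj] at hs
    exact lt_asymm hs (hpσ j)
  -- Beyond `c` the Laplace integral converges; beyond `∑ ‖z j‖` there is no zero, so `H s₀ ≠ 0`.
  set s₀ : ℝ := max c (max x (∑ j, ‖z j‖)) + 1 with hs₀
  have h1 : c < s₀ := (le_max_left _ _).trans_lt (lt_add_one _)
  have h2 : x < s₀ := ((le_max_left _ _).trans (le_max_right c _)).trans_lt (lt_add_one _)
  have h3 : ∑ j, ‖z j‖ < s₀ :=
    ((le_max_right _ _).trans (le_max_right c _)).trans_lt (lt_add_one _)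
  have h0 : closedLoop K z p s₀ = 0 := by
    refine laplace_eq_zero_of_continuation_zero (σ := σ) (x := x) hcont hnonneg hH
      (fun s hs => ?_) hσx ?_ h1 h2
    · unfold closedLoop
      exact DifferentiableAt.div (by fun_prop) (by fun_prop) (hden s hs)
    · rw [closedLoop, Finset.prod_eq_zero (Finset.mem_univ i) (by rw [hx, sub_self])]
      simp
  refine div_ne_zero (mul_ne_zero (by exact_mod_cast hK.ne') ?_) (hden s₀ ?_) h0
  · refine Finset.prod_ne_zero_iff.2 fun j _ hj => ?_
    have h4 : ‖z j‖ ≤ ∑ j, ‖z j‖ :=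
      Finset.single_le_sum (f := fun j => ‖z j‖) (fun _ _ => norm_nonneg _) (Finset.mem_univ j)
    have h5 := Complex.re_le_norm (z j)
    rw [← sub_eq_zero.1 hj, Complex.ofReal_re] at h5
    rw [← sub_eq_zero.1 hj] at h4
    linarith
  · simpa using hσx.trans h2

/-- Since a pole may not cancel a zero, `p = p₀` can be forbidden, so a right neighbourhood of `p₀`
is kept, with `N₀` independent of `p`. -/
theorem exists_fastestDecayRate_le {m : ℕ} {z : Fin m → ℂ} {F : ℝ[X]}
    (hF : F.map (algebraMap ℝ ℂ) = ∏ i, (X - C (z i))) {p₀ : ℝ}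
    (hz : ∀ (i : Fin m) (x : ℝ), z i = x → x ≤ p₀) :
    ∃ ε > 0, ∃ N₀, ∀ p : ℝ, p₀ ≤ p → p < p₀ + ε → p < 0 → (∀ i, z i ≠ p) → ∀ n ≥ N₀,
      fastestDecayRate z n ≤ p := by
  have hm : F.Monic := by
    refine monic_of_injective (algebraMap ℝ ℂ).injective ?_
    rw [hF]
    exact monic_prod_of_monic _ _ fun i _ => monic_X_sub_C _
  obtain ⟨ε, hε, N₀, h⟩ := exists_impulse_taylor_nonneg hm (p₀ := p₀) (fun r hr => by
    have h1 : (F.map (algebraMap ℝ ℂ)).eval (r : ℂ) = 0 := by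
      rw [← Complex.coe_algebraMap, eval_map_apply, hr, map_zero]
    rw [hF, eval_prod] at h1
    obtain ⟨i, -, hi⟩ := Finset.prod_eq_zero_iff.1 h1
    rw [eval_sub, eval_X, eval_C, sub_eq_zero] at hi
    exact hz i r hi.symm)
  refine ⟨ε, hε, max N₀ (m + 1), fun p hp hp' hp0 hpz n hn => ?_⟩
  have hfeas : Feasible z (fun _ : Fin n => (p : ℂ)) :=
    ⟨fun _ => by simpa using hp0, fun _ j => (hpz j).symm, 1, one_pos, _,
      isInverseLaplace_impulse hF (by omega) p,
      fun t ht => mul_nonneg (Real.exp_pos _).le (h p hp hp' n (by omega) t ht)⟩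
  have hle : fastestDecayRate z n ≤ decayRate (fun _ : Fin n => (p : ℂ)) :=
    sInf_le ⟨_, hfeas, rfl⟩
  exact hle.trans ( iSup_le fun _ => by simp)

end MonotonicTracking

theorem mainTheorem4 {m no : ℕ} (P : MonotonicTracking.Plant m no)
    (hgain : P.gain ≠ 0)
    (hzero : ∀ (i : Fin m) (x : ℝ), 0 ≤ x → P.zero i ≠ (x : ℂ)) :
    ((∃ (i : Fin m) (x : ℝ), x < 0 ∧ P.zero i = (x : ℂ)) →
      ∃ μ : ℝ, IsGreatest {x : ℝ | ∃ i : Fin m, P.zero i = (x : ℂ)} μ ∧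
        IsLeast {σ : EReal | ∃ nc : ℕ, MonotonicTracking.AdmissibleOrder m no nc ∧
          σ = MonotonicTracking.fastestDecayRate P.zero (nc + no)} (μ : EReal)) ∧
    ((¬ ∃ (i : Fin m) (x : ℝ), x < 0 ∧ P.zero i = (x : ℂ)) →
      Tendsto (fun n : ℕ => MonotonicTracking.fastestDecayRate P.zero n) atTop (𝓝 ⊥)) := by
  -- The zeros are the roots of a real monic polynomial, so the impulse responses built from it are
  -- real.
  have hF : (C P.gain⁻¹ * P.num).map (algebraMap ℝ ℂ) = ∏ i, (X - C (P.zero i)) := by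
    rw [Polynomial.map_mul, P.num_eq, map_C, ← mul_assoc, ← C_mul]
    simp [hgain]
  refine ⟨?_, fun hno => ?_⟩
  · rintro ⟨i₀, x₀, -, hx₀⟩
    have hfin : {x : ℝ | ∃ i : Fin m, P.zero i = (x : ℂ)}.Finite := by
      refine (Set.finite_range fun i => (P.zero i).re).subset ?_
      rintro x ⟨i, hi⟩
      exact ⟨i, by simp [hi]⟩
    obtain ⟨μ, hμ⟩ := hfin.isCompact.exists_isGreatest ⟨x₀, i₀, hx₀⟩
    obtain ⟨i, hi⟩ := hμ.1
    have hμ0 : μ < 0 := by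
      by_contra! h
      exact hzero i μ h hi
    have hlow : ∀ n, (μ : EReal) ≤ MonotonicTracking.fastestDecayRate P.zero n := by
      intro n
      refine le_sInf ?_
      rintro _ ⟨p, hp, rfl⟩
      exact MonotonicTracking.le_decayRate_of_feasible hp hi
    obtain ⟨ε, hε, N₀, h⟩ := MonotonicTracking.exists_fastestDecayRate_le hF (p₀ := μ)
      (fun j x hx => hμ.2 ⟨j, hx⟩)
    -- This controller order is admissible and brings the closed-loop order above `N₀`. At this
    -- single order the infimum over poles already equals `μ`.
    refine ⟨μ, hμ, ⟨N₀ + m + no + 1, ⟨by push_cast; omega, by push_cast; omega⟩,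
      le_antisymm (hlow _) ?_⟩, ?_⟩
    · by_contra! hlt
      obtain ⟨q, hq, hq'⟩ := EReal.lt_iff_exists_real_btwn.1 hlt
      have hq : μ < q := by exact_mod_cast hq
      -- A multiple pole strictly between `μ` and `q`, stable and clear of every zero, contradicts
      -- `q` being below the infimum.
      obtain ⟨p, hp, hp'⟩ := exists_between (lt_min hq (lt_min (lt_add_of_pos_right μ hε) hμ0))
      rw [lt_min_iff, lt_min_iff] at hp'
      have := h p hp.le hp'.2.1 hp'.2.2 (fun j hj => not_le_of_gt hp (hμ.2 ⟨j, hj⟩))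
        (N₀ + m + no + 1 + no) (by omega)
      refine absurd (hq'.trans_le this) (not_lt_of_ge ?_)
      exact_mod_cast hp'.1.le
    · rintro _ ⟨nc, -, rfl⟩
      exact hlow _
  · have hreal : ∀ (i : Fin m) (x : ℝ), P.zero i ≠ x := fun i x hx =>
      (lt_or_ge x 0).elim (fun h => hno ⟨i, x, h, hx⟩) fun h => hzero i x h hx
    rw [EReal.tendsto_nhds_bot_iff_real]
    intro x
    obtain ⟨p, hp⟩ := exists_lt (min x 0)
    -- Without real zeros the condition on `p₀` is vacuous, so the pole itself serves as `p₀`.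
    obtain ⟨ε, hε, N₀, h⟩ := MonotonicTracking.exists_fastestDecayRate_le hF (p₀ := p)
      (fun j y hy => absurd hy (hreal j y))
    filter_upwards [eventually_ge_atTop N₀] with n hn
    refine (h p le_rfl (lt_add_of_pos_right p hε) (lt_min_iff.1 hp).2 (hreal · p) n hn).trans_lt ?_
    exact_mod_cast (lt_min_iff.1 hp).1
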